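/- **Setting.** For $x\in\mathbb R$ let $\|x\|$ be the distance from $x$ to the nearest integer. Let $\mathfrak W$ be the set of well approximable numbers: irrational $\theta$ with $\liminf_{n\to\infty} n\|n\theta\|=0$. For real $\kappa\ge 1$ let $\mathfrak W_\kappa$ be the set of irrational $\theta$ with $\|n\theta\|<n^{-\kappa}$ for infinitely many $n\ge 1$; let $\mathfrak W_\infty=\bigcap_{\kappa>1}\mathfrak W_\kappa$ (the Liouville numbers); the exponent of an irrational $\theta$ is $\kappa(\theta)=\sup\{\kappa\in[1,\infty) : \theta\in\mathfrak W_\kappa\}\in[1,\infty]$. A number $\theta$ is *abyssal* if its regular continued fraction $\theta=[a_0a_1a_2\dots]$ contains pairwise disjoint blocks of consecutive partial quotients, all entries of all blocks being bounded by one constant, whose lengths tend to infinity. Let $\mathfrak u$ be a non-principal ultrafilter on $\mathbb N$, ${}^*\mathbb Z\subset{}^*\mathbb R$ the corresponding ultrapowers of $\mathbb Z\subset\mathbb R$, ${}^*\mathbb R_{\rm fin}$ the ring of bounded elements of ${}^*\mathbb R$, and $\langle\cdot\rangle:{}^*\mathbb R\to{}^*\mathbb R/({}^*\mathbb R_{\rm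 fin})^\times$ the associated Krull valuation, whose ordered value set (multiplicative, with the class of $0$ as smallest element) is the growth-decay semi-ring; its decay semi-ring is the set of classes of infinitesimals, i.e. $\{\mu:\mu<1\}$. For $\theta\in\mathbb R$ and $\mu,\nu$ in the decay semi-ring let ${}^*\mathbb Z^\mu_\nu(\theta)$ be the group of all $n\in{}^*\mathbb Z$ with $\langle n\rangle\cdot\mu<1$ for which there is $n^\perp\in{}^*\mathbb Z$ such that $n\theta-n^\perp$ is infinitesimal and $\langle n\theta-n^\perp\rangle\le\nu$. The flat product $\theta\,{}_\mu\!\wedge_\mu\,\eta$ is *defined* if both ${}^*\mathbb Z^\mu_\mu(\theta)\ne0$ and ${}^*\mathbb Z^\mu_\mu(\eta)\ne0$, and *undefined* otherwise. **Theorem 6.3.** For all $\kappa,\kappa'\in[1,\infty]$ there exist abyssal $\theta,\eta\in\mathfrak W$ with $\theta\in\mathfrak W_\kappa$ of exponent $\kappa(\theta)=\kappa$ and $\eta\in\mathfrak W_{\kappa'}$ of exponent $\kappa(\eta)=\kappa'$ such that, for every non-principal ultrafilter $\mathfrak u$ on $\mathbb N$ and every $\mu$ in the corresponding decay semi-ring,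 the flat product $\theta\,{}_\mu\!\wedge_\mu\,\eta$ is undefined. -/

import Mathlib

open scoped ENNReal

/-! ### Classical diophantine approximation -/

/-- The distance `‖x‖` from `x` to the nearest integer. -/
noncomputable def distNearestInt (x : ℝ) : ℝ := |x - round x|

/-- The set `𝔅` of badly approximable numbers: irrational `θ` with `liminf n‖nθ‖ > 0`. -/
def BadlyApproximable : Set ℝ :=
  {θ | Irrational θ ∧
    ∃ C : ℝ, 0 < C ∧ ∀ᶠ n : ℕ in Filter.atTop, C ≤ (n : ℝ) * distNearestInt (n * θ)}

/-- The set `𝔚 = ℝ - (ℚ ∪ 𝔅)` of well approximable numbers. -/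
def WellApproximable : Set ℝ := {θ | Irrational θ ∧ θ ∉ BadlyApproximable}

/-- The `κ`-approximable numbers, for real `κ`: irrational `θ` such that `‖nθ‖ < n ^ (-κ)` for
infinitely many positive integers `n`. -/
def KappaApproximable (κ : ℝ) : Set ℝ :=
  {θ | Irrational θ ∧ {n : ℕ | 0 < n ∧ distNearestInt (n * θ) < (n : ℝ) ^ (-κ)}.Infinite}

/-- The Liouville numbers `𝔚_∞`: the numbers that are `κ`-approximable for every `κ > 1`. -/
def LiouvilleNumbers : Set ℝ := {θ | ∀ κ : ℝ, 1 < κ → θ ∈ KappaApproximable κ}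

open Classical in
/-- The class `𝔚_κ` for `κ ∈ [1, ∞]`. -/
noncomputable def ApproxClass (κ : ℝ≥0∞) : Set ℝ :=
  if κ = ∞ then LiouvilleNumbers else KappaApproximable κ.toReal

/-- The exponent `κ(θ)`: the supremum of the real `κ ≥ 1` with `θ ∈ 𝔚_κ`. -/
noncomputable def approxExponent (θ : ℝ) : ℝ≥0∞ :=
  ⨆ (κ : ℝ) (_ : 1 ≤ κ ∧ θ ∈ KappaApproximable κ), ENNReal.ofReal κ

/-! ### Partial quotients and abysses -/

/-- The partial quotient `a_n` in the regular continued fraction `θ = [a₀ a₁ a₂ …]`;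
it is `none` when the expansion stops before `n` (which never happens for irrational `θ`). -/
noncomputable def partialQuotient (θ : ℝ) (n : ℕ) : Option ℤ :=
  (GenContFract.IntFractPair.stream θ n).map GenContFract.IntFractPair.b

/-- `θ` is abyssal: there is a sequence of pairwise disjoint blocks
`a_{i j}, a_{i j + 1}, …, a_{i j + k j}` of consecutive partial quotients of `θ`, all bounded by
one constant `M`, whose lengths tend to infinity. -/
def Abyssal (θ : ℝ) : Prop :=
  ∃ (i k : ℕ → ℕ) (M : ℤ),
    Pairwise (fun j j' => Disjoint (Set.Icc (i j) (i j + k j)) (Set.Icc (i j') (i j' + k j'))) ∧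
    (∀ j, ∀ n ∈ Set.Icc (i j) (i j + k j), ∃ a : ℤ, partialQuotient θ n = some a ∧ |a| ≤ M) ∧
    Filter.Tendsto k Filter.atTop Filter.atTop

/-! ### Ultrapowers and the growth-decay semi-ring

`u` is an ultrafilter on `ℕ`. The ultrapowers of `ℤ` and `ℝ` are `Filter.Germ u ℤ` and
`Filter.Germ u ℝ`. -/

/-- The ultrapower `*ℝ`. -/
abbrev StarReal (u : Ultrafilter ℕ) : Type := Filter.Germ (u : Filter ℕ) ℝ

/-- The ultrapower `*ℤ`. -/
abbrev StarInt (u : Ultrafilter ℕ) : Type := Filter.Germ (u : Filter ℕ) ℤ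

/-- The inclusion `*ℤ ⊆ *ℝ`. -/
noncomputable def StarInt.toReal {u : Ultrafilter ℕ} (n : StarInt u) : StarReal u :=
  Filter.Germ.map (fun k : ℤ => (k : ℝ)) n

/-- The inclusion `ℝ ⊆ *ℝ`. -/
def stdReal (u : Ultrafilter ℕ) (r : ℝ) : StarReal u := (Filter.Germ.const r : StarReal u)

theorem StarInt.toReal_zero {u : Ultrafilter ℕ} : (0 : StarInt u).toReal = 0 := by
  change ((fun _ => ((0 : ℤ) : ℝ) : ℕ → ℝ) : StarReal u) = ((fun _ => 0 : ℕ → ℝ) : StarReal u)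
  simp

theorem StarInt.toReal_add {u : Ultrafilter ℕ} (m n : StarInt u) :
    (m + n).toReal = m.toReal + n.toReal := by
  induction m using Filter.Germ.inductionOn with | _ f =>
  induction n using Filter.Germ.inductionOn with | _ g =>
  change ((fun x => ((f x + g x : ℤ) : ℝ) : ℕ → ℝ) : StarReal u)
    = ((fun x => (f x : ℝ) + (g x : ℝ) : ℕ → ℝ) : StarReal u)
  simp

theorem StarInt.toReal_neg {u : Ultrafilter ℕ} (m : StarInt u) : (-m).toReal = -m.toReal := by
  induction m using Filter.Germ.inductionOn with | _ f =>
  change ((fun x => ((-f x : ℤ) : ℝ) : ℕ → ℝ) : StarReal u)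
    = ((fun x => -(f x : ℝ) : ℕ → ℝ) : StarReal u)
  simp

theorem stdReal_add {u : Ultrafilter ℕ} (r s : ℝ) :
    stdReal u (r + s) = stdReal u r + stdReal u s := rfl

theorem stdReal_mul {u : Ultrafilter ℕ} (r s : ℝ) :
    stdReal u (r * s) = stdReal u r * stdReal u s := rfl

/-- The valuation ring `*ℝ_fin` of bounded elements of `*ℝ`. -/
def StarRealFin (u : Ultrafilter ℕ) : ValuationSubring (StarReal u) where
  carrier := {x | ∃ r : ℝ, |x| ≤ stdReal u r}
  mul_mem' := by
    rintro x y ⟨r, hr⟩ ⟨s, hs⟩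
    refine ⟨r * s, ?_⟩
    rw [abs_mul, stdReal_mul]
    exact mul_le_mul hr hs (abs_nonneg y) ((abs_nonneg x).trans hr)
  one_mem' := ⟨1, by rw [abs_one]; exact le_refl (1 : StarReal u)⟩
  add_mem' := by
    rintro x y ⟨r, hr⟩ ⟨s, hs⟩
    refine ⟨r + s, ?_⟩
    rw [stdReal_add]
    exact (abs_add_le x y).trans (add_le_add hr hs)
  zero_mem' := ⟨0, by rw [abs_zero]; exact le_refl (0 : StarReal u)⟩
  neg_mem' := by
    rintro x ⟨r, hr⟩
    exact ⟨r, by rwa [abs_neg]⟩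
  mem_or_inv_mem' := by
    intro x
    rcases le_total |x| 1 with h | h
    · exact Or.inl ⟨1, h⟩
    · refine Or.inr ⟨1, ?_⟩
      rw [abs_inv]
      exact inv_le_one_of_one_le₀ h

/-- The growth-decay semi-ring: the value group (with the class of `0` adjoined as
smallest element) of the Krull valuation of the valuation ring `*ℝ_fin`, that is, the ordered
multiplicative monoid `*ℝ / (*ℝ_fin)ˣ ≅ (*ℝ_{>0} ∪ {0}) / (*ℝ_fin)ˣ_{>0}`. -/
abbrev GrowthDecay (u : Ultrafilter ℕ) : Type := (StarRealFin u).ValueGroup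

/-- The growth-decay valuation `⟨x⟩`, the class of `x` (equivalently of `|x|`). -/
noncomputable def gdVal {u : Ultrafilter ℕ} : Valuation (StarReal u) (GrowthDecay u) := (StarRealFin u).valuation

/-- The decay semi-ring: the classes of the infinitesimals, i.e. of the elements of the maximal
ideal of `*ℝ_fin`. -/
def DecaySemiring (u : Ultrafilter ℕ) : Set (GrowthDecay u) := {μ | μ < 1}

theorem zero_mem_decaySemiring (u : Ultrafilter ℕ) : (0 : GrowthDecay u) ∈ DecaySemiring u :=
  (zero_lt_one : (0 : GrowthDecay u) < 1)

theorem gdVal_add_mem_decaySemiring {u : Ultrafilter ℕ} {x y : StarReal u}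
    (hx : gdVal x ∈ DecaySemiring u) (hy : gdVal y ∈ DecaySemiring u) :
    gdVal (x + y) ∈ DecaySemiring u :=
  Valuation.map_add_lt (gdVal (u := u)) (g := 1) hx hy

/-- The element `x` of `*ℝ` is infinitesimal. -/
def IsInfinitesimal {u : Ultrafilter ℕ} (x : StarReal u) : Prop :=
  ∀ r : ℝ, 0 < r → |x| < stdReal u r

/-- `DecaySemiring` is the set of classes of the infinitesimals. -/
theorem gdVal_mem_decaySemiring_iff {u : Ultrafilter ℕ} (x : StarReal u) :
    gdVal x ∈ DecaySemiring u ↔ IsInfinitesimal x := by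
  have hstd : ∀ r : ℝ, 0 < r → (0 : StarReal u) < stdReal u r := fun r hr =>
    Filter.Germ.const_lt hr
  have hinv : ∀ r : ℝ, stdReal u r⁻¹ = (stdReal u r)⁻¹ := fun r => rfl
  change (StarRealFin u).valuation x < 1 ↔ _
  rcases eq_or_ne x 0 with rfl | hx
  · simp only [map_zero, zero_lt_one, true_iff]
    intro r hr
    rw [abs_zero]
    exact hstd r hr
  have key : (StarRealFin u).valuation x < 1 ↔ x⁻¹ ∉ StarRealFin u := by
    rw [← not_le, ← ValuationSubring.valuation_le_one_iff, map_inv₀]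
    have h0 : 0 < (StarRealFin u).valuation x := by
      rw [zero_lt_iff]
      exact (Valuation.ne_zero_iff _).2 hx
    rw [inv_le_one₀ h0]
  rw [key]
  have hax : 0 < |x| := abs_pos.2 hx
  constructor
  · intro h r hr
    by_contra hlt
    refine h ⟨r⁻¹, ?_⟩
    rw [abs_inv, hinv]
    exact inv_anti₀ (hstd r hr) (not_lt.1 hlt)
  · rintro h ⟨r, hr⟩
    have hr0 : 0 < stdReal u r := lt_of_lt_of_le (abs_pos.2 (inv_ne_zero hx)) hr
    have hr1 : (0 : ℝ) < r := Filter.Germ.const_lt_iff.1 hr0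
    have h1 := h r⁻¹ (inv_pos.2 hr1)
    rw [hinv] at h1
    rw [abs_inv] at hr
    have h2 : (stdReal u r)⁻¹ ≤ |x| := by
      simpa using inv_anti₀ (inv_pos.2 hax) hr
    exact absurd h1 (not_lt.2 h2)

/-! ### The growth-decay bi-filtration -/

/-- The error term `nθ - p` of a pair `n, p ∈ *ℤ`. -/
noncomputable def errorTerm {u : Ultrafilter ℕ} (θ : ℝ) (n p : StarInt u) : StarReal u :=
  n.toReal * stdReal u θ - p.toReal

theorem errorTerm_zero {u : Ultrafilter ℕ} (θ : ℝ) : errorTerm θ (0 : StarInt u) 0 = 0 := by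
  simp [errorTerm, StarInt.toReal_zero]

theorem errorTerm_add {u : Ultrafilter ℕ} (θ : ℝ) (m n p q : StarInt u) :
    errorTerm θ (m + n) (p + q) = errorTerm θ m p + errorTerm θ n q := by
  simp only [errorTerm, StarInt.toReal_add]; ring

theorem errorTerm_neg {u : Ultrafilter ℕ} (θ : ℝ) (n p : StarInt u) :
    errorTerm θ (-n) (-p) = -errorTerm θ n p := by
  simp only [errorTerm, StarInt.toReal_neg]; ring

/-- The diophantine approximation group `*ℤ(θ)`: the `n ∈ *ℤ` for which there is a dual
`p ∈ *ℤ` with `nθ - p` infinitesimal. -/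
def diophantineGroup (u : Ultrafilter ℕ) (θ : ℝ) : AddSubgroup (StarInt u) where
  carrier := {n | ∃ p : StarInt u, gdVal (errorTerm θ n p) ∈ DecaySemiring u}
  zero_mem' := ⟨0, by rw [errorTerm_zero, map_zero]; exact zero_mem_decaySemiring u⟩
  add_mem' := by
    rintro m n ⟨p, hp⟩ ⟨q, hq⟩
    exact ⟨p + q, by rw [errorTerm_add]; exact gdVal_add_mem_decaySemiring hp hq⟩
  neg_mem' := by
    rintro n ⟨p, hp⟩
    exact ⟨-p, by rw [errorTerm_neg, Valuation.map_neg]; exact hp⟩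

/-- The growth filtration `*ℤ^μ`: the `n ∈ *ℤ` with `|n| · μ` infinitesimal. -/
def growthGroup {u : Ultrafilter ℕ} (μ : GrowthDecay u) : AddSubgroup (StarInt u) where
  carrier := {n | gdVal n.toReal * μ ∈ DecaySemiring u}
  zero_mem' := by
    change gdVal (0 : StarInt u).toReal * μ < 1
    rw [StarInt.toReal_zero, map_zero, zero_mul]
    exact zero_lt_one
  add_mem' := by
    intro m n hm hn
    change gdVal (m + n).toReal * μ < 1
    rw [StarInt.toReal_add]
    refine lt_of_le_of_lt (mul_le_mul_left (Valuation.map_add gdVal _ _) μ) ?_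
    rcases max_cases (gdVal m.toReal) (gdVal n.toReal) with h | h
    · rw [h.1]; exact hm
    · rw [h.1]; exact hn
  neg_mem' := by
    intro n hn
    change gdVal (-n).toReal * μ < 1
    rw [StarInt.toReal_neg, Valuation.map_neg]
    exact hn

/-- The decay filtration `*ℤ_ν(θ)`: the `n ∈ *ℤ(θ)` whose decay, the class of the infinitesimal
error term `nθ - p`, is at most `ν`. (The dual `p` of `n` is unique.) -/
def decayGroup {u : Ultrafilter ℕ} (θ : ℝ) (ν : GrowthDecay u) : AddSubgroup (StarInt u) where
  carrier := {n | ∃ p : StarInt u,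
    gdVal (errorTerm θ n p) ∈ DecaySemiring u ∧ gdVal (errorTerm θ n p) ≤ ν}
  zero_mem' := ⟨0, by rw [errorTerm_zero, map_zero]; exact ⟨zero_mem_decaySemiring u, zero_le⟩⟩
  add_mem' := by
    rintro m n ⟨p, hp, hp'⟩ ⟨q, hq, hq'⟩
    exact ⟨p + q, by
      rw [errorTerm_add]
      exact ⟨gdVal_add_mem_decaySemiring hp hq, Valuation.map_add_le _ hp' hq'⟩⟩
  neg_mem' := by
    rintro n ⟨p, hp⟩
    exact ⟨-p, by rw [errorTerm_neg, Valuation.map_neg]; exact hp⟩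

/-- The growth-decay bi-filtration `*ℤ^μ_ν(θ) = *ℤ^μ(θ) ∩ *ℤ_ν(θ)`. -/
def growthDecayGroup {u : Ultrafilter ℕ} (θ : ℝ) (μ ν : GrowthDecay u) :
    AddSubgroup (StarInt u) :=
  (growthGroup μ ⊓ diophantineGroup u θ) ⊓ decayGroup θ ν

/-- The relation between `θ` and `η` with indices `μ ≥ ν` in the decay semi-ring: the groups
`*ℤ^μ_ν(θ)` and `*ℤ^ν_μ(η)` are both non-zero, so that the growth-decay product is defined. -/
def GrowthDecayProductDefined {u : Ultrafilter ℕ} (θ η : ℝ) (μ ν : GrowthDecay u) : Prop :=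
  growthDecayGroup θ μ ν ≠ ⊥ ∧ growthDecayGroup η ν μ ≠ ⊥

/-! A non-zero element of `*ℤ^μ_μ(θ)` with `μ = ⟨m⟩` is an `n` with `|n||m|` infinitesimal and `|nθ
- p| ≤ C|m|`. Let `N ≤ |n| < M` be consecutive convergent denominators of `θ`. Best approximation
gives `|nθ - p| ≥ 1/(2M)`, so up to constants the scale `1/|m|` lies in the gap between `N` and `M`,
and `M/N` is large. If the flat product were defined, `θ` and `η` would have wide gaps around one
common scale.

It therefore suffices to make wide gaps alternate. For a fast sequence `T`, all partial quotients of
`θ` are `1` except for a jump `J q` after the first denominator `q` beyond each `T (2j)`, whose gap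
closes before `T (2j+1)`; for `η` the jumps live between `T (2j+1)` and `T (2j+2)`
(`exists_real_of_thresholds`, `not_growthDecayProductDefined`). The size of `J` is free: `J q ≈
q^(κ-1)` gives exponent `κ`, and `J → ∞` gives well approximability (`exponent_of_jumps`). Growth of
`T` beyond powers of `2` leaves ever longer runs of `1`s, the abysses. -/

/-! ### Continued fractions: existence and best approximation -/

/-- Every sequence of positive integers is the sequence of partial quotients of a real number:
the complete quotients exist. -/
theorem exists_completeQuotients (a : ℕ → ℕ) (ha : ∀ n, 1 ≤ a n) :
    ∃ x : ℕ → ℝ, (∀ n, 1 < x n) ∧ ∀ n, x n = a n + (x (n + 1))⁻¹ := by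
  have hpos : ∀ n, (1 : ℝ) ≤ a n := fun n => by exact_mod_cast ha n
  -- Compactness: the systems `E N` of the first `N` relations are nested, closed and non-empty in a
  -- compact product, so they have a common solution.
  let K : Set (ℕ → ℝ) := Set.pi Set.univ fun n => Set.Icc (a n : ℝ) (a n + 1)
  have hK : IsCompact K := isCompact_univ_pi fun n => isCompact_Icc
  have hx0 : ∀ x ∈ K, ∀ n, 1 ≤ x n := fun x hx n => (hpos n).trans (hx n trivial).1
  let E : ℕ → Set (ℕ → ℝ) := fun N => {x | x ∈ K ∧ ∀ n < N, (x n - a n) * x (n + 1) = 1}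
  have hne : ∀ N, ∀ c : ℝ, 1 ≤ c → ∃ y : ℝ, (a N : ℝ) ≤ y ∧ y ≤ a N + 1 ∧ (y - a N) * c = 1 := by
    intro N c hc
    have hc0 : 0 < c := by linarith
    refine ⟨a N + c⁻¹, ?_, ?_, ?_⟩
    · have := inv_pos.2 hc0; linarith
    · have := inv_le_one_of_one_le₀ hc; linarith
    · field_simp; ring
  have hE : ∀ N, (E N).Nonempty := by
    intro N
    -- Backward solution: coordinate `N - (r + 1)` is reset from its successor, which leaves the
    -- later relations intact.
    have : ∀ r ≤ N, ∃ x ∈ K, ∀ n < N, N - r ≤ n → (x n - a n) * x (n + 1) = 1 := by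
      intro r
      induction r with
      | zero =>
        intro _
        exact ⟨fun n => a n, fun n _ => ⟨le_rfl, by simp⟩, fun n h h' => by omega⟩
      | succ r ih =>
        intro hr
        obtain ⟨x, hxK, hx⟩ := ih (by omega)
        obtain ⟨y, h1, h2, h3⟩ := hne (N - (r + 1)) (x (N - (r + 1) + 1)) (hx0 x hxK _)
        refine ⟨Function.update x (N - (r + 1)) y, ?_, ?_⟩
        · intro n _
          rcases eq_or_ne n (N - (r + 1)) with rfl | h
          · simp [h1, h2]
          · simpa [h] using hxK n trivial
        · intro n hn hn'
          rcases eq_or_ne n (N - (r + 1)) with rfl | h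
          · simpa using h3
          · have h4 : n + 1 ≠ N - (r + 1) := by omega
            simpa [h, h4] using hx n hn (by omega)
    obtain ⟨x, hxK, hx⟩ := this N le_rfl
    exact ⟨x, hxK, fun n hn => hx n hn (by omega)⟩
  have hcl : ∀ N, IsClosed (E N) := by
    intro N
    have h1 : E N = K ∩ ⋂ n, ⋂ (_ : n < N), {x : ℕ → ℝ | (x n - a n) * x (n + 1) = 1} := by
      ext x; simp [E]
    rw [h1]
    refine hK.isClosed.inter (isClosed_iInter fun n => isClosed_iInter fun _ => ?_)
    exact isClosed_eq (by fun_prop) continuous_const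
  obtain ⟨x, hx⟩ := IsCompact.nonempty_iInter_of_sequence_nonempty_isCompact_isClosed E
    (fun N x hx => ⟨hx.1, fun n hn => hx.2 n (by omega)⟩) hE
    (hK.of_isClosed_subset (hcl 0) fun x hx => hx.1) hcl
  rw [Set.mem_iInter] at hx
  have hxK := (hx 0).1
  have h1 : ∀ n, x n = a n + (x (n + 1))⁻¹ := by
    intro n
    have h2 := (hx (n + 1)).2 n (by omega)
    have h3 : x n - a n = (x (n + 1))⁻¹ := eq_inv_of_mul_eq_one_left h2
    linarith
  refine ⟨x, fun n => ?_, h1⟩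
  rw [h1 n]
  have := inv_pos.2 (lt_of_lt_of_le one_pos (hx0 x hxK (n + 1)))
  have := hpos n
  linarith

/-- Since `x (n + 1) > 1`, its inverse is the fractional part of `x n`, so the continued fraction
algorithm runs through the `x n`. -/
theorem partialQuotient_of_completeQuotients {a : ℕ → ℕ} {x : ℕ → ℝ} (hx1 : ∀ n, 1 < x n)
    (hx : ∀ n, x n = a n + (x (n + 1))⁻¹) (n : ℕ) : partialQuotient (x 0) n = some (a n : ℤ) := by
  have hfl : ∀ n, ⌊x n⌋ = a n := by
    intro n
    rw [Int.floor_eq_iff, hx n]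
    have h1 := inv_pos.2 (one_pos.trans (hx1 (n + 1)))
    have h2 := inv_lt_one_of_one_lt₀ (hx1 (n + 1))
    push_cast
    constructor <;> linarith
  have hfr : ∀ n, Int.fract (x n) = (x (n + 1))⁻¹ := by
    intro n
    have h1 := hx n
    rw [Int.fract, hfl n]
    push_cast
    linarith
  have hst : ∀ n, GenContFract.IntFractPair.stream (x 0) n
      = some (GenContFract.IntFractPair.of (x n)) := by
    intro n
    induction n with
    | zero => rfl
    | succ n ih =>
      have h0 : (GenContFract.IntFractPair.of (x n)).fr = (x (n + 1))⁻¹ := hfr n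
      rw [GenContFract.IntFractPair.stream_succ_of_some ih, h0, inv_inv]
      rw [h0]
      exact inv_ne_zero (one_pos.trans (hx1 (n + 1))).ne'
  rw [partialQuotient, hst n]
  simp [GenContFract.IntFractPair.of, hfl n]

/-- The number with given partial quotients `a`, the denominators of whose convergents are `t`
(preceded by `s`): approximation by the convergents and the law of best approximation. -/
theorem exists_real_of_partialQuotients (a s t : ℕ → ℕ) (ha : ∀ n, 1 ≤ a n)
    (hs0 : s 0 = 0) (ht0 : t 0 = 1) (hs : ∀ k, s (k + 1) = t k)
    (ht : ∀ k, t (k + 1) = a (k + 1) * t k + s k) :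
    ∃ θ : ℝ, Irrational θ ∧ (∀ n, partialQuotient θ n = some (a n : ℤ)) ∧
      (∀ k, ∃ p : ℤ, |t k * θ - p| * t (k + 1) < 1) ∧
      ∀ (k : ℕ) (n p : ℤ), n ≠ 0 → |n| < t (k + 1) → 1 ≤ |n * θ - p| * (2 * t (k + 1)) := by
  obtain ⟨x, hx1, hx⟩ := exists_completeQuotients a ha
  have htpos : ∀ k, 1 ≤ t k := by
    intro k
    induction k with
    | zero => omega
    | succ k ih => rw [ht]; nlinarith [ha (k + 1)]
  have hst : ∀ k, s k ≤ t k := by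
    intro k
    cases k with
    | zero => omega
    | succ k => rw [ht, hs]; nlinarith [ha (k + 1), Nat.zero_le (s k)]
  -- numerators of the convergents
  obtain ⟨uv, huv0, huv⟩ : ∃ uv : ℕ → ℤ × ℤ, uv 0 = (1, (a 0 : ℤ)) ∧
      ∀ k, uv (k + 1) = ((uv k).2, a (k + 1) * (uv k).2 + (uv k).1) :=
    ⟨fun n => Nat.rec (1, (a 0 : ℤ)) (fun k w => (w.2, a (k + 1) * w.2 + w.1)) n, rfl,
      fun k => rfl⟩
  obtain ⟨u, v, hu0, hv0, hu, hv⟩ : ∃ u v : ℕ → ℤ, u 0 = 1 ∧ v 0 = a 0 ∧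
      (∀ k, u (k + 1) = v k) ∧ ∀ k, v (k + 1) = a (k + 1) * v k + u k :=
    ⟨fun k => (uv k).1, fun k => (uv k).2, by simp [huv0], by simp [huv0],
      fun k => by simp [huv], fun k => by simp [huv]⟩
  set θ := x 0 with hθ
  -- Squaring the determinant avoids tracking its alternating sign.
  have hdet : ∀ k, ((t k : ℤ) * u k - s k * v k) ^ 2 = 1 := by
    intro k
    induction k with
    | zero => simp [hs0, ht0, hu0]
    | succ k ih =>
      rw [hu, hv, hs, ht, ← ih]
      push_cast
      ring
  -- Consecutive errors have ratio `-x (k + 1)`: they alternate in sign.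
  have hD : ∀ k, (s k * θ - u k) = - x (k + 1) * (t k * θ - v k) := by
    intro k
    induction k with
    | zero =>
      have h1 := hx 0
      have h2 : x 1 ≠ 0 := (one_pos.trans (hx1 1)).ne'
      simp only [hs0, ht0, hu0, hv0, hθ]
      rw [zero_add] at *
      rw [h1]
      push_cast
      field_simp
      ring
    | succ k ih =>
      have h1 := hx (k + 1)
      have h2 : x (k + 1 + 1) ≠ 0 := (one_pos.trans (hx1 _)).ne'
      rw [hu, hv, hs, ht]
      push_cast
      have h3 : ((a (k + 1) * t k + s k : ℝ) * θ - (a (k + 1) * v k + u k))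
          = (a (k + 1) - x (k + 1)) * (t k * θ - v k) := by linear_combination ih
      rw [h3, h1]
      field_simp
      ring
  -- The exact size of the error; `a (k + 1) < x (k + 1) < a (k + 1) + 1` turns it into the two
  -- bounds `hup` and `hlow`.
  have habs : ∀ k, |t k * θ - v k| * (x (k + 1) * t k + s k) = 1 := by
    intro k
    have h1 : ((t k * θ - v k) * (x (k + 1) * t k + s k)) ^ 2 = 1 := by
      have h2 : (((t k : ℤ) * u k - s k * v k : ℤ) : ℝ) ^ 2 = 1 := by exact_mod_cast hdet k
      rw [← h2]
      push_cast
      have h3 : ((t k : ℝ) * u k - s k * v k)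
          = (t k * θ - v k) * (x (k + 1) * t k + s k) := by linear_combination - (t k : ℝ) * hD k
      rw [h3]
    have h4 : 0 ≤ x (k + 1) * t k + s k := by
      have := (one_pos.trans (hx1 (k + 1))).le
      positivity
    rw [← abs_of_nonneg h4, ← abs_mul]
    rwa [← sq_eq_sq₀ (abs_nonneg _) zero_le_one, sq_abs, one_pow]
  have hDpos : ∀ k, 0 < |t k * θ - v k| := by
    intro k
    rcases (abs_nonneg (t k * θ - v k)).eq_or_lt with h | h
    · have := habs k
      rw [← h] at this
      simp at this
    · exact h
  have hxgt : ∀ k, (a k : ℝ) < x k := fun k => by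
    have := inv_pos.2 (one_pos.trans (hx1 (k + 1)))
    rw [hx k]; linarith
  have hxlt : ∀ k, x k < a k + 1 := fun k => by
    have := inv_lt_one_of_one_lt₀ (hx1 (k + 1))
    rw [hx k]; linarith
  have hup : ∀ k, |t k * θ - v k| * t (k + 1) < 1 := by
    intro k
    rw [← habs k, ht]
    refine mul_lt_mul_of_pos_left ?_ (hDpos k)
    have h1 : (1 : ℝ) ≤ t k := by exact_mod_cast htpos k
    have := hxgt (k + 1)
    push_cast
    nlinarith
  have hlow : ∀ k, 1 ≤ |t k * θ - v k| * (2 * t (k + 1)) := by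
    intro k
    rw [← habs k]
    refine mul_le_mul_of_nonneg_left ?_ (hDpos k).le
    have h1 : (1 : ℝ) ≤ t k := by exact_mod_cast htpos k
    have h2 : (t k : ℝ) ≤ t (k + 1) := by exact_mod_cast (hs k) ▸ hst (k + 1)
    have h3 : (t (k + 1) : ℝ) = a (k + 1) * t k + s k := by exact_mod_cast ht k
    have := hxlt (k + 1)
    nlinarith
  have hgrow : ∀ k, k ≤ t (k + 1) := by
    intro k
    induction k with
    | zero => omega
    | succ k ih =>
      rw [ht (k + 1), hs]
      nlinarith [ha (k + 1 + 1), htpos k]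
  refine ⟨θ, ?_, partialQuotient_of_completeQuotients hx1 hx, fun k => ⟨v k, hup k⟩, ?_⟩
  -- For a rational of denominator `k`, the non-zero error of the convergent of index `k` is at
  -- least `1/k`, yet less than `1 / t (k + 1) ≤ 1/k`.
  · rintro ⟨r, hr⟩
    have h1 := hup r.den
    have h2 := hDpos r.den
    set k := r.den
    have hd : (0 : ℝ) < k := by exact_mod_cast r.den_pos
    have hrd : θ * k = r.num := by
      rw [← hr]; exact_mod_cast Rat.mul_den_eq_num r
    have h3 : (t k * θ - v k) * k = ((t k * r.num - v k * k : ℤ) : ℝ) := by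
      push_cast; rw [← hrd]; ring
    have h4 : |t k * θ - v k| * k = ((|t k * r.num - v k * k| : ℤ) : ℝ) := by
      rw [Int.cast_abs, ← h3, abs_mul, abs_of_pos hd]
    have h5 : 0 < |t k * θ - v k| * k := by positivity
    rw [h4] at h5
    have h6 : (1 : ℤ) ≤ |t k * r.num - v k * k| := by
      have : (0 : ℤ) < |t k * r.num - v k * k| := by exact_mod_cast h5
      omega
    have h7 : (1 : ℝ) ≤ |t k * θ - v k| * k := by rw [h4]; exact_mod_cast h6
    have h8 : (k : ℝ) ≤ t (k + 1) := by exact_mod_cast hgrow k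
    nlinarith
  · intro k n p hn hlt
    refine (hlow k).trans (mul_le_mul_of_nonneg_right ?_ (by positivity))
    -- coordinates of `(n, p)` in the basis of two consecutive convergents
    obtain ⟨e, f, h1, h2⟩ : ∃ e f : ℤ, n = e * t k + f * t (k + 1) ∧
        p = e * v k + f * v (k + 1) := by
      have hd := hdet (k + 1)
      rw [hu, hs] at hd
      set d : ℤ := t (k + 1) * v k - t k * v (k + 1)
      refine ⟨d * (t (k + 1) * p - v (k + 1) * n), d * (v k * n - t k * p), ?_, ?_⟩
      · linear_combination -n * hd
      · linear_combination -p * hd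
    have h3 : n * θ - p = e * (t k * θ - v k) + f * (t (k + 1) * θ - v (k + 1)) := by
      rw [h1, h2]; push_cast; ring
    have h4 := hD (k + 1)
    rw [hu, hs] at h4
    set D := t (k + 1) * θ - v (k + 1)
    have hx2 := hx1 (k + 1 + 1)
    have htk : (1 : ℤ) ≤ t k := by exact_mod_cast htpos k
    have htk1 : (1 : ℤ) ≤ t (k + 1) := by exact_mod_cast htpos (k + 1)
    have he : e ≠ 0 := by
      rintro rfl
      have hf : f ≠ 0 := by rintro rfl; simp at h1; exact hn h1
      rw [h1, zero_mul, zero_add, abs_mul, abs_of_pos (by omega : (0 : ℤ) < t (k + 1))] at hlt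
      have := Int.one_le_abs hf
      nlinarith
    -- Equal signs would force `|n| ≥ t (k + 1)`. With opposite signs of `e`, `f` and of the two
    -- errors, the contributions add up instead of cancelling.
    have hef : e * f ≤ 0 := by
      by_contra! hc
      rcases lt_or_gt_of_ne he with h | h
      · have hf : f < 0 := by by_contra! hf; nlinarith
        have := neg_abs_le n
        nlinarith
      · have hf : 0 < f := by by_contra! hf; nlinarith
        have := le_abs_self n
        nlinarith
    have he1 : (1 : ℝ) ≤ |(e : ℝ)| := by exact_mod_cast Int.one_le_abs he
    have hef' : (e : ℝ) * f ≤ 0 := by exact_mod_cast hef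
    rw [h3, h4]
    have h5 : e * (-x (k + 1 + 1) * D) + f * D = (f - e * x (k + 1 + 1)) * D := by ring
    rw [h5, abs_mul, abs_mul, abs_neg, abs_of_pos (by linarith : 0 < x (k + 1 + 1))]
    refine mul_le_mul_of_nonneg_right ?_ (abs_nonneg _)
    rcases lt_or_gt_of_ne he with h | h
    · have h' : (e : ℝ) < 0 := by exact_mod_cast h
      have hf : (0 : ℝ) ≤ f := by by_contra! hf; nlinarith
      rw [abs_of_neg h'] at he1
      refine le_trans ?_ (le_abs_self _)
      nlinarith
    · have h' : (0 : ℝ) < e := by exact_mod_cast h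
      have hf : (f : ℝ) ≤ 0 := by by_contra! hf; nlinarith
      rw [abs_of_pos h'] at he1
      refine le_trans ?_ (neg_le_abs _)
      nlinarith

/-! ### Sparse jumps at prescribed thresholds -/

/-- A number whose partial quotients equal `1`, except for a partial quotient `J q` after each
first denominator `q` beyond one of the thresholds `S j`. -/
theorem exists_real_of_thresholds (J S U : ℕ → ℕ) (hJ : ∀ q, 1 ≤ J q) (hS0 : 2 ≤ S 0)
    (hSU : ∀ j, S j ≤ U j) (hU : ∀ j q, q < 2 * S j → (J q + 1) * q ≤ U j)
    (hUS : ∀ j, 2 ^ j * U j < S (j + 1)) :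
    ∃ θ : ℝ, Irrational θ ∧ Abyssal θ ∧
      (∀ j, ∃ q : ℕ, S j ≤ q ∧ ∃ p : ℤ, |q * θ - p| * (J q * q) < 1) ∧
      ∀ n p : ℤ, n ≠ 0 → ∃ N M : ℕ, 1 ≤ N ∧ N ≤ |n| ∧ |n| < M ∧ 1 ≤ |n * θ - p| * (2 * M) ∧
        M ≤ (J N + 1) * N ∧ (M ≤ 2 * N ∨ ∃ j, S j ≤ N ∧ M ≤ U j) := by
  classical
  have hSlt : ∀ j, U j < S (j + 1) := fun j =>
    lt_of_le_of_lt (Nat.le_mul_of_pos_left _ (by positivity)) (hUS j)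
  have hSmono : StrictMono S := strictMono_nat_of_lt_succ fun j => (hSU j).trans_lt (hSlt j)
  -- the sequence of partial quotients
  let A : ℕ × ℕ → ℕ := fun w => if ∃ j, w.1 < S j ∧ S j ≤ w.2 then J w.2 else 1
  -- The next partial quotient depends on the denominators already built, so the recursion runs on
  -- pairs of consecutive denominators.
  obtain ⟨w, hw0, hw⟩ : ∃ w : ℕ → ℕ × ℕ, w 0 = (0, 1) ∧
      ∀ k, w (k + 1) = ((w k).2, A (w k) * (w k).2 + (w k).1) :=
    ⟨fun n => Nat.rec (0, 1) (fun _ z => (z.2, A z * z.2 + z.1)) n, rfl, fun k => rfl⟩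
  obtain ⟨a, s, t, hs0, ht0, hs, ht, hjump, hone, ha0⟩ : ∃ a s t : ℕ → ℕ, s 0 = 0 ∧ t 0 = 1 ∧
      (∀ k, s (k + 1) = t k) ∧ (∀ k, t (k + 1) = a (k + 1) * t k + s k) ∧
      (∀ k, (∃ j, s k < S j ∧ S j ≤ t k) → a (k + 1) = J (t k)) ∧
      (∀ k, (¬ ∃ j, s k < S j ∧ S j ≤ t k) → a (k + 1) = 1) ∧ a 0 = 1 :=
    ⟨fun n => Nat.casesOn n 1 fun k => A (w k), fun k => (w k).1, fun k => (w k).2,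
      by simp [hw0], by simp [hw0], fun k => by simp [hw], fun k => by simp [hw],
      fun k h => if_pos h, fun k h => if_neg h, rfl⟩
  clear_value A
  clear hw0 hw
  have ha : ∀ n, 1 ≤ a n := by
    intro n
    cases n with
    | zero => omega
    | succ k =>
      by_cases h : ∃ j, s k < S j ∧ S j ≤ t k
      · rw [hjump k h]; exact hJ _
      · rw [hone k h]
  have htpos : ∀ k, 1 ≤ t k := by
    intro k
    induction k with
    | zero => omega
    | succ k ih => rw [ht]; nlinarith [ha (k + 1)]
  have htmono : Monotone t := monotone_nat_of_le_succ fun k => by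
    rw [ht]; nlinarith [ha (k + 1), Nat.zero_le (s k)]
  have hst : ∀ k, s k ≤ t k := by
    intro k
    cases k with
    | zero => omega
    | succ k => rw [hs]; exact htmono (by omega)
  have htunb : ∀ k, k ≤ t (k + 1) := by
    intro k
    induction k with
    | zero => omega
    | succ k ih =>
      rw [ht (k + 1), hs]
      nlinarith [ha (k + 1 + 1), htpos k]
  have hle : ∀ k, t (k + 1) ≤ (a (k + 1) + 1) * t k := fun k => by
    rw [ht, add_mul, one_mul]; have := hst k; omega
  have hstep : ∀ k, (¬ ∃ j, s k < S j ∧ S j ≤ t k) → t (k + 1) ≤ 2 * t k := fun k h => by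
    have := hle k
    rwa [hone k h] at this
  -- the first denominator beyond a threshold is close to it
  have hcross : ∀ k j, s k < S j → S j ≤ t k → t k < 2 * S j := by
    intro k
    induction k with
    | zero =>
      intro j _ h
      have := hSmono.monotone (Nat.zero_le j)
      omega
    | succ k ih =>
      intro j h1 h2
      rw [hs] at h1
      -- A jump beyond `S i` lands at most at `U i < S (i + 1)`, so it cannot cross a further
      -- threshold; every crossing is made by a step that at most doubles.
      by_cases h : ∃ i, s k < S i ∧ S i ≤ t k
      · obtain ⟨i, h3, h4⟩ := h
        have h5 := hU i _ (ih i h3 h4)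
        have h6 := hle k
        rw [hjump k ⟨i, h3, h4⟩] at h6
        have h7 : i < j := hSmono.lt_iff_lt.1 (h4.trans_lt h1)
        have h8 := hSmono.monotone (show i + 1 ≤ j from h7)
        have := hSlt i
        omega
      · have := hstep k h
        omega
  have hland : ∀ k j, s k < S j → S j ≤ t k → t (k + 1) ≤ U j := by
    intro k j h1 h2
    have h5 := hU j _ (hcross k j h1 h2)
    have h6 := hle k
    rw [hjump k ⟨j, h1, h2⟩] at h6
    omega
  have hex : ∀ j, ∃ k, s k < S j ∧ S j ≤ t k := by
    intro j
    have h0 : ∃ k, S j ≤ t k := ⟨S j + 1, htunb _⟩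
    refine ⟨Nat.find h0, ?_, Nat.find_spec h0⟩
    rcases hk : Nat.find h0 with _ | k
    · rw [hs0]
      have := hSmono.monotone (Nat.zero_le j)
      omega
    · rw [hs]
      exact not_le.1 (Nat.find_min h0 (by omega))
  obtain ⟨θ, hirr, hpq, happ, hbest⟩ :=
    exists_real_of_partialQuotients a s t ha hs0 ht0 hs ht
  refine ⟨θ, hirr, ?_, ?_, ?_⟩
  · choose c hc1 hc2 using hex
    -- After the jump, `r ≤ j` doublings stay below `2 ^ j * U j < S (j + 1)`; no threshold is met
    -- and the quotients remain `1`.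
    have hbd : ∀ j r, r ≤ j → t (c j + 1 + r) ≤ 2 ^ r * U j ∧ a (c j + 1 + r + 1) = 1 := by
      intro j
      have hno : ∀ r, t (c j + 1 + r) ≤ 2 ^ r * U j → r ≤ j →
          ¬ ∃ i, s (c j + 1 + r) < S i ∧ S i ≤ t (c j + 1 + r) := by
        rintro r h hr ⟨i, h1, h2⟩
        have h3 : t (c j) ≤ s (c j + 1 + r) := by
          rw [show c j + 1 + r = (c j + r) + 1 by omega, hs]
          exact htmono (by omega)
        have h4 : j < i := hSmono.lt_iff_lt.1 (((hc2 j).trans h3).trans_lt h1)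
        have h5 := hSmono.monotone (show j + 1 ≤ i from h4)
        have h6 := hUS j
        have h7 : 2 ^ r * U j ≤ 2 ^ j * U j :=
          Nat.mul_le_mul_right _ (Nat.pow_le_pow_right (by omega) hr)
        omega
      intro r
      induction r with
      | zero =>
        intro hr
        have h := hland (c j) j (hc1 j) (hc2 j)
        have h' : t (c j + 1 + 0) ≤ 2 ^ 0 * U j := by simpa using h
        exact ⟨h', hone _ (hno _ h' hr)⟩
      | succ r ih =>
        intro hr
        obtain ⟨h1, h2⟩ := ih (by omega)
        have h3 := hle (c j + 1 + r)
        rw [h2] at h3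
        have h' : t (c j + 1 + (r + 1)) ≤ 2 ^ (r + 1) * U j := by
          rw [pow_succ]
          rw [show c j + 1 + (r + 1) = c j + 1 + r + 1 by omega]
          nlinarith
        exact ⟨h', hone _ (hno _ h' hr)⟩
    have hsep : ∀ j j', j < j' → c j + 2 + j < c j' + 2 := by
      intro j j' h
      have h1 := (hbd j j le_rfl).1
      have h2 := hUS j
      have h3 := hSmono.monotone (show j + 1 ≤ j' from h)
      have h4 := hc2 j'
      have h5 : c j + 1 + j < c j' := by
        by_contra! h6
        have := htmono h6
        omega
      omega
    -- The jump is the quotient of index `c j + 1`; the run of `1`s starts one place later.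
    refine ⟨fun j => c j + 2, fun j => j, 1, ?_, ?_, Filter.tendsto_id⟩
    · intro j j' hjj
      rw [Set.disjoint_left]
      rintro n ⟨h1, h2⟩ ⟨h3, h4⟩
      dsimp only at h1 h2 h3 h4
      rcases lt_or_gt_of_ne hjj with h | h
      · have := hsep _ _ h; omega
      · have := hsep _ _ h; omega
    · rintro j n ⟨h1, h2⟩
      refine ⟨a n, hpq n, ?_⟩
      dsimp only at h1 h2
      have h3 := (hbd j (n - (c j + 2)) (by omega)).2
      rw [show c j + 1 + (n - (c j + 2)) + 1 = n by omega] at h3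
      simp [h3]
  · intro j
    obtain ⟨k, h1, h2⟩ := hex j
    obtain ⟨p, hp⟩ := happ k
    refine ⟨t k, h2, p, lt_of_le_of_lt (mul_le_mul_of_nonneg_left ?_ (abs_nonneg _)) hp⟩
    rw [ht, hjump k ⟨j, h1, h2⟩]
    push_cast
    have : (0 : ℝ) ≤ s k := by positivity
    linarith
  · intro n p hn
    -- The least such `k` gives the consecutive denominators `t k ≤ |n| < t (k + 1)`.
    have h0 : ∃ k, |n| < t (k + 1) :=
      ⟨n.natAbs + 1, by
        have := htunb (n.natAbs + 1)
        rw [Int.abs_eq_natAbs]; omega⟩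
    have hfind := Nat.find_spec h0
    have hN : (t (Nat.find h0) : ℤ) ≤ |n| := by
      rcases hk : Nat.find h0 with _ | k
      · rw [ht0]; exact_mod_cast Int.one_le_abs hn
      · exact not_lt.1 (Nat.find_min h0 (by omega))
    set k := Nat.find h0
    refine ⟨t k, t (k + 1), htpos k, hN, hfind, hbest k n p hn hfind, ?_, ?_⟩
    · by_cases h : ∃ i, s k < S i ∧ S i ≤ t k
      · have := hle k
        rwa [hjump k h] at this
      · refine (hstep k h).trans (Nat.mul_le_mul_right _ ?_)
        have := hJ (t k)
        omega
    · by_cases h : ∃ i, s k < S i ∧ S i ≤ t k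
      · obtain ⟨i, h1, h2⟩ := h
        exact Or.inr ⟨i, h2, hland k i h1 h2⟩
      · exact Or.inl (hstep k h)

/-! ### Jump size and exponent -/

/-- A quotient `J q` after the denominator `q` gives an error of order `1 / (J q * q)`, so `J q ≈ q
^ (κ - 1)` is right for finite `κ`. The added logarithm makes `J` unbounded even for `κ = 1` without
changing the exponent; `q ^ q` serves `κ = ∞`. The lower bound includes `r = κ`, as membership in
`𝔚_κ` itself requires. -/
theorem exists_jump_function (κ : ℝ≥0∞) (hκ : 1 ≤ κ) :
    ∃ J : ℕ → ℕ, (∀ q, 1 ≤ J q) ∧ Filter.Tendsto J Filter.atTop Filter.atTop ∧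
      (∀ r : ℝ, ENNReal.ofReal r ≤ κ → ∀ᶠ q : ℕ in Filter.atTop, (q : ℝ) ^ r ≤ J q * q) ∧
      ∀ r : ℝ, κ < ENNReal.ofReal r →
        ∀ᶠ q : ℕ in Filter.atTop, 2 * ((J q + 1) * q : ℝ) ≤ (q : ℝ) ^ r := by
  rcases eq_or_ne κ ∞ with rfl | htop
  · refine ⟨fun q => q ^ q + 1, fun q => Nat.le_add_left 1 _, ?_, ?_, by simp⟩
    · refine Filter.tendsto_atTop_mono (fun q => ?_) Filter.tendsto_id
      rcases Nat.eq_zero_or_pos q with rfl | h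
      · simp
      · exact (Nat.le_self_pow h.ne' q).trans (Nat.le_succ _)
    · intro r _
      filter_upwards [Filter.eventually_ge_atTop 1,
        tendsto_natCast_atTop_atTop.eventually (Filter.eventually_ge_atTop r)] with q hq hr
      have hq' : (1 : ℝ) ≤ q := by exact_mod_cast hq
      have h1 : (q : ℝ) ^ r ≤ (q : ℝ) ^ q := by
        rw [← Real.rpow_natCast]
        exact Real.rpow_le_rpow_of_exponent_le hq' hr
      push_cast
      have : (0 : ℝ) ≤ (q : ℝ) ^ q := by positivity
      nlinarith
  · obtain ⟨k, rfl, hk⟩ : ∃ k : ℝ, κ = ENNReal.ofReal k ∧ 1 ≤ k := by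
      refine ⟨κ.toReal, (ENNReal.ofReal_toReal htop).symm, ?_⟩
      simpa using ENNReal.toReal_mono htop hκ
    have hlog : Filter.Tendsto (fun q : ℕ => ⌈Real.log q⌉₊) Filter.atTop Filter.atTop :=
      tendsto_nat_ceil_atTop.comp (Real.tendsto_log_atTop.comp tendsto_natCast_atTop_atTop)
    refine ⟨fun q => ⌈(q : ℝ) ^ (k - 1)⌉₊ + ⌈Real.log q⌉₊ + 1, fun q => Nat.le_add_left 1 _, ?_, ?_, ?_⟩
    · exact Filter.tendsto_atTop_mono (fun q => by omega) hlog
    · intro r hr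
      have hr' : r ≤ k := (ENNReal.ofReal_le_ofReal_iff (by linarith)).1 hr
      filter_upwards [Filter.eventually_ge_atTop 1] with q hq
      have hq' : (1 : ℝ) ≤ q := by exact_mod_cast hq
      have h1 : (q : ℝ) ^ r ≤ (q : ℝ) ^ (k - 1) * q := by
        rw [← Real.rpow_add_one (by linarith)]
        exact Real.rpow_le_rpow_of_exponent_le hq' (by linarith)
      refine h1.trans (mul_le_mul_of_nonneg_right ?_ (by linarith))
      have := Nat.le_ceil ((q : ℝ) ^ (k - 1))
      push_cast
      have h2 : (0 : ℝ) ≤ (⌈Real.log q⌉₊ : ℝ) := by positivity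
      linarith
    · intro r hr
      have hr' : k < r := (ENNReal.ofReal_lt_ofReal_iff_of_nonneg (by linarith)).1 hr
      have h1 : (fun x : ℝ => x ^ (k - 1)) =o[Filter.atTop] fun x : ℝ => x ^ (r - 1) := by
        refine (Asymptotics.isLittleO_iff_tendsto' ?_).2 ?_
        · filter_upwards [Filter.eventually_gt_atTop 0] with x hx h0
          exact absurd h0 (Real.rpow_pos_of_pos hx _).ne'
        · refine (tendsto_rpow_neg_atTop (sub_pos.2 hr')).congr' ?_
          filter_upwards [Filter.eventually_gt_atTop 0] with x hx
          rw [← Real.rpow_sub hx]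
          congr 1
          ring
      have h2 : Real.log =o[Filter.atTop] fun x : ℝ => x ^ (r - 1) :=
        isLittleO_log_rpow_atTop (by linarith)
      -- The `4` collects two roundings up, the `1` in `J` and the `1` in `J q + 1`.
      have h3 : (fun _ : ℝ => (4 : ℝ)) =o[Filter.atTop] fun x : ℝ => x ^ (r - 1) := by
        refine Asymptotics.isLittleO_const_left.2 (Or.inr ?_)
        exact Filter.tendsto_abs_atTop_atTop.comp (tendsto_rpow_atTop (by linarith))
      have h4 := ((h1.add h2).add h3).bound (show (0 : ℝ) < 1 / 2 by norm_num)
      filter_upwards [Filter.eventually_ge_atTop 1, tendsto_natCast_atTop_atTop.eventually h4]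
        with q hq h
      have hq' : (1 : ℝ) ≤ q := by exact_mod_cast hq
      have h5 : (0 : ℝ) ≤ (q : ℝ) ^ (r - 1) := by positivity
      have h6 : (0 : ℝ) ≤ (q : ℝ) ^ (k - 1) := by positivity
      have h7 := Real.log_nonneg hq'
      rw [Real.norm_of_nonneg h5, Real.norm_of_nonneg (by positivity)] at h
      have h8 := Nat.ceil_lt_add_one h6
      have h9 := Nat.ceil_lt_add_one h7
      have h10 : (q : ℝ) ^ r = (q : ℝ) ^ (r - 1) * q := by
        rw [← Real.rpow_add_one (by linarith)]; congr 1; ring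
      rw [h10, ← mul_assoc]
      refine mul_le_mul_of_nonneg_right ?_ (by linarith)
      push_cast
      linarith

theorem distNearestInt_le (x : ℝ) (p : ℤ) : distNearestInt x ≤ |x - p| := round_le x p

/-- The arithmetic of a number with jumps `J q` at arbitrarily large denominators `q`. -/
theorem exponent_of_jumps {κ : ℝ≥0∞} (hκ : 1 ≤ κ) {J : ℕ → ℕ} {θ : ℝ} (hirr : Irrational θ)
    (hJ : Filter.Tendsto J Filter.atTop Filter.atTop)
    (hlow : ∀ r : ℝ, ENNReal.ofReal r ≤ κ → ∀ᶠ q : ℕ in Filter.atTop, (q : ℝ) ^ r ≤ J q * q)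
    (hup : ∀ r : ℝ, κ < ENNReal.ofReal r →
        ∀ᶠ q : ℕ in Filter.atTop, 2 * ((J q + 1) * q : ℝ) ≤ (q : ℝ) ^ r)
    (happ : ∀ Q : ℕ, ∃ q : ℕ, Q ≤ q ∧ ∃ p : ℤ, |q * θ - p| * (J q * q) < 1)
    (hbest : ∀ n p : ℤ, n ≠ 0 → ∃ N M : ℕ, 1 ≤ N ∧ N ≤ |n| ∧ |n| < M ∧
      1 ≤ |n * θ - p| * (2 * M) ∧ M ≤ (J N + 1) * N) :
    θ ∈ WellApproximable ∧ θ ∈ ApproxClass κ ∧ approxExponent θ = κ := by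
  have hmem : ∀ r : ℝ, ENNReal.ofReal r ≤ κ → θ ∈ KappaApproximable r := by
    intro r hr
    refine ⟨hirr, Set.infinite_of_forall_exists_gt fun b => ?_⟩
    obtain ⟨Q, hQ⟩ := Filter.eventually_atTop.1 (hlow r hr)
    obtain ⟨q, hq, p, hp⟩ := happ (max Q (b + 1))
    have hqb : b + 1 ≤ q := (le_max_right _ _).trans hq
    refine ⟨q, ⟨by omega, ?_⟩, by omega⟩
    have hq0 : (0 : ℝ) < q := by exact_mod_cast (by omega : 0 < q)
    refine (distNearestInt_le _ p).trans_lt ?_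
    rw [Real.rpow_neg hq0.le, ← one_div, lt_div_iff₀ (by positivity)]
    exact lt_of_le_of_lt
      (mul_le_mul_of_nonneg_left (hQ q ((le_max_left _ _).trans hq)) (abs_nonneg _)) hp
  have hnot : ∀ r : ℝ, κ < ENNReal.ofReal r → θ ∉ KappaApproximable r := by
    rintro r hr ⟨-, hinf⟩
    have hr1 : 1 < r := by
      by_contra! h
      exact absurd (hκ.trans_lt hr) (not_lt.2 (by simpa using ENNReal.ofReal_le_ofReal h))
    obtain ⟨Q, hQ⟩ := Filter.eventually_atTop.1 (hup r hr)
    -- Beyond `B`, the denominator `N` preceding `n` is at least `Q`; then `2 * M ≤ N ^ r ≤ n ^ r`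
    -- contradicts best approximation.
    obtain ⟨B, hB⟩ : ∃ B : ℕ, ∀ N < Q, (J N + 1) * N ≤ B :=
      ⟨∑ N ∈ Finset.range Q, (J N + 1) * N, fun N hN =>
        Finset.single_le_sum (f := fun N => (J N + 1) * N) (fun _ _ => Nat.zero_le _)
          (Finset.mem_range.2 hN)⟩
    obtain ⟨n, ⟨hn0, hn⟩, hnB⟩ := hinf.exists_gt B
    obtain ⟨N, M, h1, h2, h3, h4, h5⟩ := hbest n (round (n * θ)) (by exact_mod_cast hn0.ne')
    rw [Nat.abs_cast] at h2 h3
    have hNn : N ≤ n := by exact_mod_cast h2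
    have hnM : n < M := by exact_mod_cast h3
    have hQN : Q ≤ N := by
      by_contra! h
      have := hB N h
      omega
    have hn0' : (0 : ℝ) < n := by exact_mod_cast hn0
    have h6 := hQ N hQN
    have h7 : (N : ℝ) ^ r ≤ (n : ℝ) ^ r :=
      Real.rpow_le_rpow (by positivity) (by exact_mod_cast hNn) (by linarith)
    have h8 : (M : ℝ) ≤ (J N + 1) * N := by exact_mod_cast h5
    have h9 : 0 < (n : ℝ) ^ r := by positivity
    rw [distNearestInt, Real.rpow_neg hn0'.le] at hn
    rw [Int.cast_natCast] at h4
    have h10 : |n * θ - round (n * θ)| * (2 * M) < ((n : ℝ) ^ r)⁻¹ * (n : ℝ) ^ r := by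
      have hM0 : (0 : ℝ) < 2 * M := by
        have : (0 : ℝ) < M := by exact_mod_cast (by omega : 0 < M)
        linarith
      calc _ < ((n : ℝ) ^ r)⁻¹ * (2 * M) := mul_lt_mul_of_pos_right hn hM0
        _ ≤ _ := mul_le_mul_of_nonneg_left (by linarith) (by positivity)
    rw [inv_mul_cancel₀ h9.ne'] at h10
    linarith
  refine ⟨⟨hirr, ?_⟩, ?_, le_antisymm ?_ ?_⟩
  · rintro ⟨-, C, hC, hev⟩
    obtain ⟨n₀, hn₀⟩ := Filter.eventually_atTop.1 hev
    obtain ⟨Q, hQ⟩ := Filter.eventually_atTop.1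
      ((tendsto_natCast_atTop_atTop.comp hJ).eventually (Filter.eventually_ge_atTop C⁻¹))
    obtain ⟨q, hq, p, hp⟩ := happ (max Q n₀)
    have h1 := hn₀ q ((le_max_right _ _).trans hq)
    have h2 : C⁻¹ ≤ (J q : ℝ) := hQ q ((le_max_left _ _).trans hq)
    have h3 := distNearestInt_le (q * θ) p
    have h4 : C ≤ q * |q * θ - p| := h1.trans (mul_le_mul_of_nonneg_left h3 (by positivity))
    have h5 : C * C⁻¹ ≤ (q * |q * θ - p|) * J q := mul_le_mul h4 h2 (by positivity) (by positivity)
    rw [mul_inv_cancel₀ hC.ne'] at h5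
    linarith
  · rw [ApproxClass]
    split_ifs with h
    · exact fun r _ => hmem r (h ▸ le_top)
    · exact hmem _ (ENNReal.ofReal_toReal h).le
  · exact iSup₂_le fun r hr => not_lt.1 fun h => hnot r h hr.2
  · refine le_of_forall_lt fun c hc => ?_
    obtain ⟨d, hcd, hd⟩ := exists_between hc
    -- The supremum runs over exponents at least `1` only, while `d` may be smaller.
    have hd' : max d 1 ≤ κ := max_le hd.le hκ
    have htop : max d 1 ≠ ∞ := (max_lt (hd.trans_le le_top) ENNReal.one_lt_top).ne
    have h1 : ENNReal.ofReal (max d 1).toReal = max d 1 := ENNReal.ofReal_toReal htop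
    refine (hcd.trans_le (le_max_left d 1)).trans_le ?_
    rw [← h1]
    refine le_iSup₂_of_le (max d 1).toReal ⟨?_, hmem _ (h1.trans_le hd')⟩ le_rfl
    simpa using ENNReal.toReal_mono htop (le_max_right d 1)

/-! ### From the ultrapower to real scales -/

/-- The quotient `f / g` lies in `*ℝ_fin`, hence is bounded by one standard real; if `g = 0` in the
ultrapower, so is `f`. -/
theorem exists_bound_of_gdVal_le {u : Ultrafilter ℕ} {f g : ℕ → ℝ}
    (h : gdVal (f : StarReal u) ≤ gdVal (g : StarReal u)) :
    ∃ C : ℝ, ∀ᶠ i in (u : Filter ℕ), |f i| ≤ C * |g i| := by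
  obtain ⟨c, hc⟩ : ∃ c ∈ StarRealFin u, c * (g : StarReal u) = f := by
    rcases eq_or_ne (g : StarReal u) 0 with h0 | h0
    · rw [h0, map_zero, le_zero_iff, map_eq_zero] at h
      exact ⟨0, zero_mem _, by rw [h, zero_mul]⟩
    · refine ⟨f / g, ?_, div_mul_cancel₀ _ h0⟩
      rw [← ValuationSubring.valuation_le_one_iff, map_div₀]
      exact div_le_one_of_le₀ h zero_le
  obtain ⟨⟨r, hr⟩, hc⟩ := hc
  refine ⟨r, Filter.Germ.coe_le.1 ?_⟩
  have h1 : |(f : StarReal u)| ≤ stdReal u r * |(g : StarReal u)| := by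
    rw [← hc, abs_mul]
    exact mul_le_mul_of_nonneg_right hr (abs_nonneg _)
  rwa [Filter.Germ.abs_def, Filter.Germ.abs_def] at h1

theorem eventually_of_gdVal_lt_one {u : Ultrafilter ℕ} {f : ℕ → ℝ}
    (h : gdVal (f : StarReal u) < 1) {δ : ℝ} (hδ : 0 < δ) :
    ∀ᶠ i in (u : Filter ℕ), |f i| < δ := by
  have h1 := (gdVal_mem_decaySemiring_iff _).1 h δ hδ
  rw [Filter.Germ.abs_def] at h1
  exact Filter.Germ.coe_lt.1 h1

/-- Non-triviality of `*ℤ^μ_μ(θ)` in terms of representatives. -/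
theorem exists_of_growthDecayGroup_ne_bot {u : Ultrafilter ℕ} {θ : ℝ} {m : ℕ → ℝ}
    (h : growthDecayGroup θ (gdVal (m : StarReal u)) (gdVal (m : StarReal u)) ≠ ⊥) :
    ∃ (n p : ℕ → ℤ) (C : ℝ), ∀ δ : ℝ, 0 < δ → ∀ᶠ i in (u : Filter ℕ),
      n i ≠ 0 ∧ |n i * θ - p i| ≤ C * |m i| ∧ |(n i : ℝ)| * |m i| < δ := by
  obtain ⟨⟨N, hmem⟩, hN0⟩ := AddSubgroup.ne_bot_iff_exists_ne_zero.1 h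
  have hN : N ≠ 0 := fun h => hN0 (Subtype.ext h)
  obtain ⟨⟨hgrow, -⟩, P, -, hdec⟩ := hmem
  induction N using Filter.Germ.inductionOn with | _ n =>
  induction P using Filter.Germ.inductionOn with | _ p =>
  have hgrow' : gdVal ((fun i => (n i : ℝ) * m i : ℕ → ℝ) : StarReal u) < 1 := by
    have : gdVal (StarInt.toReal (n : StarInt u) * (m : StarReal u)) < 1 := by
      rw [map_mul]; exact hgrow
    exact this
  obtain ⟨C, hC⟩ := exists_bound_of_gdVal_le (u := u) (f := fun i => n i * θ - p i) (g := m) hdec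
  refine ⟨n, p, C, fun δ hδ => ?_⟩
  have hn : ∀ᶠ i in (u : Filter ℕ), n i ≠ 0 := by
    rw [Ultrafilter.eventually_not]
    exact fun h0 => hN (Filter.Germ.coe_eq.2 h0)
  filter_upwards [hn, hC, eventually_of_gdVal_lt_one hgrow' hδ] with i h1 h2 h3
  exact ⟨h1, h2, by rwa [← abs_mul]⟩

/-- If the approximations of `θ` and `η` that are better than the trivial ones happen at
interleaving scales, no growth-decay product of `θ` and `η` with equal indices is defined. -/
theorem not_growthDecayProductDefined {θ η : ℝ} {T : ℕ → ℕ} (hT : StrictMono T)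
    (hθ : ∀ n p : ℤ, n ≠ 0 → ∃ N M : ℕ, (N : ℤ) ≤ |n| ∧ |n| < M ∧ 1 ≤ |n * θ - p| * (2 * M) ∧
      (M ≤ 2 * N ∨ ∃ j, T (2 * j) ≤ N ∧ M ≤ T (2 * j + 1)))
    (hη : ∀ n p : ℤ, n ≠ 0 → ∃ N M : ℕ, (N : ℤ) ≤ |n| ∧ |n| < M ∧ 1 ≤ |n * η - p| * (2 * M) ∧
      (M ≤ 2 * N ∨ ∃ j, T (2 * j + 1) ≤ N ∧ M ≤ T (2 * j + 1 + 1)))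
    (u : Ultrafilter ℕ) (μ : GrowthDecay u) : ¬ GrowthDecayProductDefined θ η μ μ := by
  rintro ⟨h1, h2⟩
  obtain ⟨x, rfl⟩ := ValuationSubring.valuation_surjective (StarRealFin u) μ
  induction x using Filter.Germ.inductionOn with | _ m =>
  obtain ⟨n, p, C, hC⟩ := exists_of_growthDecayGroup_ne_bot h1
  obtain ⟨n', p', C', hC'⟩ := exists_of_growthDecayGroup_ne_bot h2
  set D := max 1 (max C C')
  have hD : 1 ≤ D := le_max_left _ _
  have hCD : C ≤ D := (le_max_left _ _).trans (le_max_right _ _)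
  have hCD' : C' ≤ D := (le_max_right _ _).trans (le_max_right _ _)
  -- With `y = 2 * D * |m i|` this `δ` yields `2 * N < 1 / y ≤ M`, for `θ` and `η` alike. One index
  -- `i` suffices for the contradiction.
  have hδ : (0 : ℝ) < (4 * D)⁻¹ := by positivity
  obtain ⟨i, ⟨a1, a2, a3⟩, b1, b2, b3⟩ := ((hC _ hδ).and (hC' _ hδ)).exists
  -- the scale `1 / |m i|` lies between the denominators `N` and `M`
  have key : ∀ {ξ E : ℝ} {n p : ℤ} {N M : ℕ}, |n * ξ - p| ≤ E * |m i| → E ≤ D →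
      |(n : ℝ)| * |m i| < (4 * D)⁻¹ → (N : ℤ) ≤ |n| → 1 ≤ |n * ξ - p| * (2 * M) →
      2 * (N * (2 * D * |m i|)) < 1 ∧ 1 ≤ M * (2 * D * |m i|) := by
    intro ξ E n p N M c1 c2 c3 c4 c5
    have hm := abs_nonneg (m i)
    have c6 : (N : ℝ) ≤ |(n : ℝ)| := by exact_mod_cast c4
    constructor
    · have c7 : (N : ℝ) * |m i| < (4 * D)⁻¹ := (mul_le_mul_of_nonneg_right c6 hm).trans_lt c3
      rw [← one_div, lt_div_iff₀ (by positivity)] at c7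
      linarith
    · have c8 : |n * ξ - p| ≤ D * |m i| := c1.trans (mul_le_mul_of_nonneg_right c2 hm)
      have := mul_le_mul_of_nonneg_right c8 (show (0 : ℝ) ≤ 2 * M by positivity)
      linarith
  have hy : 0 ≤ 2 * D * |m i| := by positivity
  obtain ⟨N, M, d1, -, d3, d4⟩ := hθ _ (p i) a1
  obtain ⟨N', M', e1, -, e3, e4⟩ := hη _ (p' i) b1
  obtain ⟨f1, f2⟩ := key a2 hCD a3 d1 d3
  obtain ⟨g1, g2⟩ := key b2 hCD' b3 e1 e3
  set y := 2 * D * |m i|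
  have hlt : ∀ {K L : ℕ}, 2 * ((K : ℝ) * y) < 1 → 1 ≤ (L : ℝ) * y → 2 * K < L := by
    intro K L h h'
    by_contra! hLK
    have : (L : ℝ) ≤ 2 * K := by exact_mod_cast hLK
    have := mul_le_mul_of_nonneg_right this hy
    linarith
  have k1 := hlt f1 f2
  have k2 := hlt f1 g2
  have k3 := hlt g1 f2
  have k4 := hlt g1 g2
  -- The ratio exceeds `2`, so both gaps come from jumps. Then `N < M'` forces `j ≤ l` and `N' < M`
  -- forces `l < j`.
  obtain ⟨j, hj1, hj2⟩ := d4.resolve_left (by omega)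
  obtain ⟨l, hl1, hl2⟩ := e4.resolve_left (by omega)
  have m1 : 2 * j < 2 * l + 1 + 1 := hT.lt_iff_lt.1 (by omega)
  have m2 : 2 * l + 1 < 2 * j + 1 := hT.lt_iff_lt.1 (by omega)
  omega

/-! ### Assembling the interleaved pair -/

/-- A sequence growing faster than prescribed. -/
theorem exists_fast_sequence (G : ℕ → ℕ) : ∃ T : ℕ → ℕ, 2 ≤ T 0 ∧ StrictMono T ∧
    (∀ j q, q < 2 * T j → G q ≤ T (j + 1)) ∧ ∀ j, 2 ^ j * T j < T (j + 1) := by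
  obtain ⟨T, hT0, hT⟩ : ∃ T : ℕ → ℕ, T 0 = 2 ∧
      ∀ j, T (j + 1) = ∑ q ∈ Finset.range (2 * T j), G q + 2 ^ j * T j + 1 :=
    ⟨fun n => Nat.rec 2 (fun j w => ∑ q ∈ Finset.range (2 * w), G q + 2 ^ j * w + 1) n, rfl,
      fun _ => rfl⟩
  have h2 : ∀ j, 2 ^ j * T j < T (j + 1) := fun j => by rw [hT]; omega
  refine ⟨T, hT0.ge, strictMono_nat_of_lt_succ fun j =>
    (Nat.le_mul_of_pos_left _ (by positivity)).trans_lt (h2 j), fun j q hq => ?_, h2⟩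
  have := Finset.single_le_sum (f := G) (fun _ _ => Nat.zero_le _) (Finset.mem_range.2 hq)
  rw [hT]
  omega

/-- Numbers of prescribed exponent with jumps beyond prescribed thresholds. -/
theorem exists_abyssal_of_thresholds {κ : ℝ≥0∞} (hκ : 1 ≤ κ) {J S U : ℕ → ℕ} (hJ : ∀ q, 1 ≤ J q)
    (hJtop : Filter.Tendsto J Filter.atTop Filter.atTop)
    (hlow : ∀ r : ℝ, ENNReal.ofReal r ≤ κ → ∀ᶠ q : ℕ in Filter.atTop, (q : ℝ) ^ r ≤ J q * q)
    (hup : ∀ r : ℝ, κ < ENNReal.ofReal r →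
        ∀ᶠ q : ℕ in Filter.atTop, 2 * ((J q + 1) * q : ℝ) ≤ (q : ℝ) ^ r)
    (hS0 : 2 ≤ S 0) (hSU : ∀ j, S j ≤ U j) (hU : ∀ j q, q < 2 * S j → (J q + 1) * q ≤ U j)
    (hUS : ∀ j, 2 ^ j * U j < S (j + 1)) :
    ∃ θ : ℝ, θ ∈ WellApproximable ∧ Abyssal θ ∧ θ ∈ ApproxClass κ ∧ approxExponent θ = κ ∧
      ∀ n p : ℤ, n ≠ 0 → ∃ N M : ℕ, (N : ℤ) ≤ |n| ∧ |n| < M ∧ 1 ≤ |n * θ - p| * (2 * M) ∧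
        (M ≤ 2 * N ∨ ∃ j, S j ≤ N ∧ M ≤ U j) := by
  obtain ⟨θ, hirr, haby, happ, hbest⟩ := exists_real_of_thresholds J S U hJ hS0 hSU hU hUS
  have hS : StrictMono S := strictMono_nat_of_lt_succ fun j =>
    (hSU j).trans_lt ((Nat.le_mul_of_pos_left _ (by positivity)).trans_lt (hUS j))
  obtain ⟨h1, h2, h3⟩ := exponent_of_jumps hκ hirr hJtop hlow hup
    (fun Q => (happ Q).imp fun q hq => ⟨hS.le_apply.trans hq.1, hq.2⟩)
    (fun n p hn => by
      obtain ⟨N, M, a1, a2, a3, a4, a5, -⟩ := hbest n p hn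
      exact ⟨N, M, a1, a2, a3, a4, a5⟩)
  refine ⟨θ, h1, haby, h2, h3, fun n p hn => ?_⟩
  obtain ⟨N, M, -, a2, a3, a4, -, a6⟩ := hbest n p hn
  exact ⟨N, M, a2, a3, a4, a6⟩

theorem theorem6p3 (κ κ' : ℝ≥0∞) (hκ : 1 ≤ κ) (hκ' : 1 ≤ κ') :
    ∃ θ η : ℝ,
      θ ∈ WellApproximable ∧ η ∈ WellApproximable ∧
      Abyssal θ ∧ Abyssal η ∧
      θ ∈ ApproxClass κ ∧ approxExponent θ = κ ∧
      η ∈ ApproxClass κ' ∧ approxExponent η = κ' ∧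
      ∀ u : Ultrafilter ℕ, (∀ k : ℕ, u ≠ pure k) →
        ∀ μ ∈ DecaySemiring u, ¬ GrowthDecayProductDefined θ η μ μ := by
  obtain ⟨J, hJ, hJtop, hlow, hup⟩ := exists_jump_function κ hκ
  obtain ⟨J', hJ', hJtop', hlow', hup'⟩ := exists_jump_function κ' hκ'
  -- The sum dominates the jumps of both numbers, so a single `T` accommodates either kind between
  -- any two consecutive terms.
  obtain ⟨T, hT0, hT, hTG, hT2⟩ := exists_fast_sequence fun q => (J q + 1) * q + (J' q + 1) * q
  have hpow : ∀ j i, j ≤ i → 2 ^ j * T i < T (i + 1) := fun j i h =>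
    (Nat.mul_le_mul_right _ (Nat.pow_le_pow_right (by omega) h)).trans_lt (hT2 i)
  obtain ⟨θ, h1, h2, h3, h4, h5⟩ := exists_abyssal_of_thresholds hκ (S := fun j => T (2 * j))
    (U := fun j => T (2 * j + 1)) hJ hJtop hlow hup hT0
    (fun j => hT.monotone (Nat.le_succ _))
    (fun j q hq => (Nat.le_add_right _ _).trans (hTG _ q hq)) (fun j => hpow j _ (by omega))
  obtain ⟨η, h1', h2', h3', h4', h5'⟩ := exists_abyssal_of_thresholds hκ'
    (S := fun j => T (2 * j + 1)) (U := fun j => T (2 * j + 1 + 1)) hJ' hJtop' hlow' hup'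
    (hT0.trans (hT.monotone (Nat.zero_le _)))
    (fun j => hT.monotone (Nat.le_succ _))
    (fun j q hq => (Nat.le_add_left _ _).trans (hTG _ q hq)) (fun j => hpow j _ (by omega))
  exact ⟨θ, η, h1, h1', h2, h2', h3, h4, h3', h4', fun u _ μ _ =>
    not_growthDecayProductDefined hT h5 h5' u μ⟩
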